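/- Let $\mathcal H^{\mathrm{dif}}=\mathbb C\langle a_1,a_2,\dots\rangle$ be the free associative unital algebra, put $a_0=1$ and $A(x)=\sum_{n\ge 0}a_nx^{n+1}$. It is a Hopf algebra whose co-product $\Delta^{\mathrm{dif}}$ is the algebra homomorphism determined by $$\Delta^{\mathrm{dif}}A(x)=\langle z^{-1}\rangle\, A(z)\otimes\frac1{z-A(x)},$$ where $\frac1{z-A(x)}=\sum_{j\ge0}A(x)^jz^{-j-1}$ and $\langle z^{-1}\rangle$ takes the coefficient of $z^{-1}$, and whose co-unit is the algebra homomorphism with $\varepsilon(a_n)=0$ for $n\ge1$. Let $Y_\infty$ be the set of rooted planar binary trees, $|t|$ the number of internal vertices of $t$, $\|$ the tree without internal vertices, $r\vee s$ the grafting of $r$ (left) and $s$ (right) on a new root, and $V(t)=\|\vee t$. Let $\widetilde{\mathcal H}^\alpha=\mathbb C Y_\infty$ be the vector space spanned by all trees, with the over product $t/s$ (graft the root of $t$ on the left-most leaf of $s$) and unit $\|$. It is a Hopf algebra whose co-product $\Delta^\alpha$ and right co-action $\delta^\alpha$ on itself are the linear maps defined simultaneously by $$\Delta^\alpha\|=\delta^\alpha\|=\|\otimes\|,\qquad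 \delta^\alpha V(r)=(V\otimes\mathrm{Id})\delta^\alpha(r),\qquad \Delta^\alpha V(r)=\|\otimes V(r)+\delta^\alpha V(r),$$ $$\Delta^\alpha(r\vee s)=\Delta^\alpha(r)/\Delta^\alpha V(s),\qquad \delta^\alpha(r\vee s)=\Delta^\alpha(r)/\delta^\alpha V(s),$$ and whose co-unit sends $\|$ to $1$ and every other tree to $0$. For $n\ge0$ let $t_n=\sum_{|t|=n}t$ (so $t_0=\|$), and let $\Omega:\mathcal H^{\mathrm{dif}}\to\widetilde{\mathcal H}^\alpha$ be the homomorphism of unital algebras with $\Omega(a_n)=t_n$ for all $n\ge 1$. **Theorem.** $\Omega$ is injective and is a homomorphism of co-algebras, i.e. $\Delta^\alpha\circ\Omega=(\Omega\otimes\Omega)\circ\Delta^{\mathrm{dif}}$ and $\varepsilon\circ\Omega=\varepsilon$. Hence $\mathcal H^{\mathrm{dif}}$ is a Hopf sub-algebra of $\widetilde{\mathcal H}^\alpha$: $\Omega$ commutes with the antipodes, and its image is a subalgebra $B$ with $\Delta^\alpha(B)\subseteq B\otimes B$ that is stable under the antipode. Moreover, for all $n\ge0$, $$\delta^\alpha(t_n)=\sum_{k=0}^n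 t_k\otimes Q^{(k-1)}_{n-k}(t),$$ where, for $m,n\ge0$, $Q^{(n)}_m(t)=\sum_{j_0+\dots+j_n=m,\ j_i\ge0}t_{j_0}/t_{j_1}/\cdots/t_{j_n}$, and $Q^{(-1)}_0(t)=1$, $Q^{(-1)}_m(t)=0$ for $m>0$. -/

import Mathlib

open scoped TensorProduct

noncomputable section

namespace NCDiff

/-! ### Generalities -/

/-- For a sequence `c` in a (not necessarily commutative) algebra, with `c 0` playing the role of
the unit, `Qpoly c N m` is the sum of all ordered products `c j₁ * ⋯ * c j_N` of `N` factors with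
`j₁ + ⋯ + j_N = m`. In terms of the polynomials `Q_m^{(n)}` (sums over `j₀ + ⋯ + j_n = m` of
products of `n + 1` factors) the upper index is shifted by one:
`Qpoly c (n + 1) m = Q_m^{(n)}(c)`, and `Qpoly c 0 m = Q_m^{(-1)}(c)`, the empty product if `m = 0`
and `0` if `m > 0`. -/
def Qpoly {R : Type*} [Semiring R] (c : ℕ → R) (N m : ℕ) : R :=
  ∑ j ∈ Finset.Nat.antidiagonalTuple N m, (List.ofFn fun i => c (j i)).prod

/-- A subalgebra of a Hopf algebra is a Hopf subalgebra if the co-product maps it into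
`B ⊗ B` and the antipode maps it into itself. -/
def IsHopfSubalgebra {H : Type*} [Ring H] [HopfAlgebra ℂ H] (B : Subalgebra ℂ H) : Prop :=
  (∀ x ∈ B, Coalgebra.comul (R := ℂ) x ∈
      LinearMap.range (TensorProduct.map B.val.toLinearMap B.val.toLinearMap)) ∧
    ∀ x ∈ B, HopfAlgebra.antipode ℂ x ∈ B

section Antihom

variable {H : Type*} [Ring H] [Algebra ℂ H]

/-- An algebra map to the opposite algebra, as a linear endomorphism. -/
def unopLin (S : H →ₐ[ℂ] Hᵐᵒᵖ) : H →ₗ[ℂ] H :=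
  (MulOpposite.opLinearEquiv ℂ).symm.toLinearMap ∘ₗ S.toLinearMap

theorem unopLin_one (S : H →ₐ[ℂ] Hᵐᵒᵖ) : unopLin S 1 = 1 := by simp [unopLin]

theorem unopLin_mul (S : H →ₐ[ℂ] Hᵐᵒᵖ) (x y : H) :
    unopLin S (x * y) = unopLin S y * unopLin S x := by simp [unopLin]

theorem left_key (S : H →ₐ[ℂ] Hᵐᵒᵖ) (w : H ⊗[ℂ] H) (v₁ v₂ : H) :
    LinearMap.mul' ℂ H ((unopLin S).rTensor H (w * (v₁ ⊗ₜ v₂))) =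
      unopLin S v₁ * LinearMap.mul' ℂ H ((unopLin S).rTensor H w) * v₂ := by
  induction w with
  | zero => simp
  | add w₁ w₂ h₁ h₂ => simp only [add_mul, mul_add, map_add, h₁, h₂]
  | tmul w₁ w₂ => simp [unopLin_mul, mul_assoc]

theorem left_gen (S : H →ₐ[ℂ] Hᵐᵒᵖ) (w v : H ⊗[ℂ] H) :
    LinearMap.mul' ℂ H ((unopLin S).rTensor H (w * v)) =
      LinearMap.mul' ℂ H ((unopLin S).rTensor H
        ((1 ⊗ₜ LinearMap.mul' ℂ H ((unopLin S).rTensor H w)) * v)) := by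
  induction v with
  | zero => simp
  | add v₁ v₂ h₁ h₂ => simp only [mul_add, map_add, h₁, h₂]
  | tmul v₁ v₂ => rw [left_key]; simp [mul_assoc]

theorem left_aux (S : H →ₐ[ℂ] Hᵐᵒᵖ) (w v : H ⊗[ℂ] H) (c : ℂ)
    (h : LinearMap.mul' ℂ H ((unopLin S).rTensor H w) = algebraMap ℂ H c) :
    LinearMap.mul' ℂ H ((unopLin S).rTensor H (w * v)) =
      algebraMap ℂ H c * LinearMap.mul' ℂ H ((unopLin S).rTensor H v) := by
  induction v with
  | zero => simp
  | add v₁ v₂ h₁ h₂ => simp only [mul_add, map_add, h₁, h₂]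
  | tmul v₁ v₂ =>
    rw [left_key, h, ← Algebra.commutes c (unopLin S v₁)]
    simp [mul_assoc]

theorem right_aux (S : H →ₐ[ℂ] Hᵐᵒᵖ) (w v : H ⊗[ℂ] H) (c : ℂ)
    (h : LinearMap.mul' ℂ H ((unopLin S).lTensor H v) = algebraMap ℂ H c) :
    LinearMap.mul' ℂ H ((unopLin S).lTensor H (w * v)) =
      algebraMap ℂ H c * LinearMap.mul' ℂ H ((unopLin S).lTensor H w) := by
  induction w with
  | zero => simp
  | add v₁ v₂ h₁ h₂ => simp only [add_mul, mul_add, map_add, h₁, h₂]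
  | tmul w₁ w₂ =>
    have key : ∀ v : H ⊗[ℂ] H,
        LinearMap.mul' ℂ H ((unopLin S).lTensor H ((w₁ ⊗ₜ w₂) * v)) =
          w₁ * LinearMap.mul' ℂ H ((unopLin S).lTensor H v) * unopLin S w₂ := by
      intro v
      induction v with
      | zero => simp
      | add w₁ w₂ h₁ h₂ => simp only [add_mul, mul_add, map_add, h₁, h₂]
      | tmul v₁ v₂ => simp [unopLin_mul, mul_assoc]
    rw [key, h, ← Algebra.commutes c w₁]
    simp [mul_assoc]

end Antihom

/-! ### The Hopf algebra of formal diffeomorphisms -/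

/-- The free associative unital algebra `ℂ⟨a₁, a₂, …⟩`; the `n`-th free generator is `a_{n+1}`. -/
def Hdif : Type := FreeAlgebra ℂ ℕ

namespace Hdif

instance instRing : Ring Hdif := inferInstanceAs (Ring (FreeAlgebra ℂ ℕ))
instance instAlgebra : Algebra ℂ Hdif := inferInstanceAs (Algebra ℂ (FreeAlgebra ℂ ℕ))

/-- The generators `a_n`, with the convention `a₀ = 1`. -/
def a : ℕ → Hdif
  | 0 => 1
  | n + 1 => FreeAlgebra.ι ℂ n

/-- The unital algebra map out of `Hdif` with `a_{n+1} ↦ f n`. -/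
def lift {B : Type*} [Ring B] [Algebra ℂ B] (f : ℕ → B) : Hdif →ₐ[ℂ] B := FreeAlgebra.lift ℂ f

theorem lift_a {B : Type*} [Ring B] [Algebra ℂ B] (f : ℕ → B) (n : ℕ) :
    lift f (a (n + 1)) = f n := FreeAlgebra.lift_ι_apply f n

theorem hom_ext {B : Type*} [Ring B] [Algebra ℂ B] {f g : Hdif →ₐ[ℂ] B}
    (h : ∀ n, f (a (n + 1)) = g (a (n + 1))) : f = g :=
  FreeAlgebra.hom_ext (funext h)

theorem induction {P : Hdif → Prop} (h0 : ∀ c : ℂ, P (algebraMap ℂ Hdif c))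
    (h1 : ∀ n, P (a (n + 1))) (hm : ∀ x y, P x → P y → P (x * y))
    (ha : ∀ x y, P x → P y → P (x + y)) (x : Hdif) : P x :=
  FreeAlgebra.induction ℂ ℕ h0 h1 hm ha x

/-- The generating series `A(x) = x + ∑_{n ≥ 1} a_n x^{n+1} = ∑_{n ≥ 0} a_n x^{n+1}`. -/
def A : PowerSeries Hdif := PowerSeries.mk fun
  | 0 => 0
  | n + 1 => a n

/-- The coefficient of `x^m` in `A(x)^j`. -/
def c (j m : ℕ) : Hdif := PowerSeries.coeff m (A ^ j)

/-- The coefficient of `x^m` in the residue `⟨z⁻¹⟩ A(z) ⊗ 1/(z - A(x))`. Expanding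
`1/(z - A(x)) = ∑_j A(x)^j z^{-j-1}`, the residue in `z` is `∑_j [z^j]A(z) ⊗ A(x)^j`; the terms with
`j > m` do not contribute to the coefficient of `x^m`, since `A(x)` has no constant term. -/
def residueCoeff (m : ℕ) : Hdif ⊗[ℂ] Hdif :=
  ∑ j ∈ Finset.range (m + 1), PowerSeries.coeff j A ⊗ₜ[ℂ] PowerSeries.coeff m (A ^ j)

/-- The co-product: the algebra map with `Δ A(x) = ⟨z⁻¹⟩ A(z) ⊗ 1/(z - A(x))`, so that `Δ a_n` is
the coefficient of `x^{n+1}` on the right-hand side. -/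
def Δ : Hdif →ₐ[ℂ] Hdif ⊗[ℂ] Hdif := lift fun n => residueCoeff (n + 2)

/-- The co-unit: the algebra map with `ε a_n = 0` for `n ≥ 1`. -/
def ε : Hdif →ₐ[ℂ] ℂ := lift fun _ => 0

theorem c_add (i j m : ℕ) : c (i + j) m =
    ∑ p ∈ Finset.HasAntidiagonal.antidiagonal m, c i p.1 * c j p.2 := by
  simp [c, pow_add, PowerSeries.coeff_mul]

theorem c_zero (m : ℕ) : c 0 m = if m = 0 then 1 else 0 := by
  simp [c, PowerSeries.coeff_one]

theorem c_one_zero : c 1 0 = 0 := by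
  simp only [c, pow_one, A, PowerSeries.coeff_mk]

theorem c_one_succ (n : ℕ) : c 1 (n + 1) = a n := by
  simp only [c, pow_one, A, PowerSeries.coeff_mk]

theorem c_lt {j : ℕ} : ∀ {m : ℕ}, m < j → c j m = 0 := by
  induction j with
  | zero => intro m h; omega
  | succ j ih =>
    intro m h
    rw [c_add]
    refine Finset.sum_eq_zero fun p hp => ?_
    rw [Finset.HasAntidiagonal.mem_antidiagonal] at hp
    by_cases h1 : p.1 < j
    · rw [ih h1, zero_mul]
    · have : p.2 = 0 := by omega
      rw [this, c_one_zero, mul_zero]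

theorem c_self (j : ℕ) : c j j = 1 := by
  induction j with
  | zero => simp [c_zero]
  | succ j ih =>
    rw [c_add, Finset.sum_eq_single (j, 1)]
    · rw [ih, show (1 : ℕ) = 0 + 1 from rfl, c_one_succ]; simp [a]
    · intro p hp hne
      rw [Finset.HasAntidiagonal.mem_antidiagonal] at hp
      by_cases h1 : p.1 < j
      · rw [c_lt h1, zero_mul]
      · have : p.2 = 0 := by
          by_contra h2
          exact hne (Prod.ext (by simp; omega) (by simp; omega))
        rw [this, c_one_zero, mul_zero]
    · intro h; simp at h

theorem Δ_c_one (m N : ℕ) (h : m < N) :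
    Δ (c 1 m) = ∑ i ∈ Finset.range N, c 1 i ⊗ₜ[ℂ] c i m := by
  have h1 : ∑ i ∈ Finset.range N, c 1 i ⊗ₜ[ℂ] c i m = residueCoeff m := by
    symm
    unfold residueCoeff
    refine (Finset.sum_congr rfl fun j _ => by simp only [c, pow_one]).trans
      (Finset.sum_subset (f := fun i => c 1 i ⊗ₜ[ℂ] c i m) (s₁ := Finset.range (m + 1)) ?_ ?_)
    · intro x hx; simp at hx ⊢; omega
    · intro x _ hx
      simp at hx
      rw [c_lt (show m < x by omega), TensorProduct.tmul_zero]
  rw [h1]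
  match m with
  | 0 =>
    rw [c_one_zero, map_zero]
    have := c_one_zero
    simp only [c, pow_one] at this
    simp [residueCoeff, this]
  | 1 =>
    have h2 : c 1 1 = 1 := c_self 1
    have h0 := c_one_zero
    rw [h2, map_one]
    simp only [c, pow_one] at h2 h0
    simp [residueCoeff, Finset.sum_range_succ, h2, h0, Algebra.TensorProduct.one_def]
  | n + 2 => rw [c_one_succ, Δ, lift_a]

theorem Δ_c (j : ℕ) : ∀ m N : ℕ, m < N →
    Δ (c j m) = ∑ i ∈ Finset.range N, c j i ⊗ₜ[ℂ] c i m := by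
  induction j with
  | zero =>
    intro m N h
    rw [Finset.sum_eq_single 0]
    · simp only [c_zero]
      split_ifs <;> simp [Algebra.TensorProduct.one_def]
    · intro i _ hi; simp [c_zero, hi]
    · intro h0; simp at h0; omega
  | succ j ih =>
    intro m N h
    have e1 : Δ (c (j + 1) m) = ∑ x ∈ Finset.range N ×ˢ Finset.range N,
        (c j x.1 * c 1 x.2) ⊗ₜ[ℂ] c (x.1 + x.2) m := by
      rw [c_add, map_sum]
      have : ∀ p ∈ Finset.HasAntidiagonal.antidiagonal m, Δ (c j p.1 * c 1 p.2) =
          ∑ x ∈ Finset.range N ×ˢ Finset.range N,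
            (c j x.1 * c 1 x.2) ⊗ₜ[ℂ] (c x.1 p.1 * c x.2 p.2) := by
        intro p hp
        rw [Finset.HasAntidiagonal.mem_antidiagonal] at hp
        rw [map_mul, ih p.1 N (by omega), Δ_c_one p.2 N (by omega), Finset.sum_mul_sum,
          Finset.sum_product]
        simp
      rw [Finset.sum_congr rfl this, Finset.sum_comm]
      refine Finset.sum_congr rfl fun x _ => ?_
      rw [c_add, TensorProduct.tmul_sum]
    have e2 : ∑ x ∈ Finset.range N ×ˢ Finset.range N,
        (c j x.1 * c 1 x.2) ⊗ₜ[ℂ] c (x.1 + x.2) m =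
        ∑ x ∈ (Finset.range N ×ˢ Finset.range N).filter (fun x => x.1 + x.2 ∈ Finset.range N),
        (c j x.1 * c 1 x.2) ⊗ₜ[ℂ] c (x.1 + x.2) m := by
      symm
      refine Finset.sum_subset (Finset.filter_subset _ _) ?_
      intro x hx hx'
      have : m < x.1 + x.2 := by
        simp at hx hx'; have := hx' hx.1 hx.2; omega
      rw [c_lt this, TensorProduct.tmul_zero]
    rw [e1, e2, ← Finset.sum_fiberwise_of_maps_to (t := Finset.range N) (g := fun x : ℕ × ℕ => x.1 + x.2)
      (fun x hx => (Finset.mem_filter.1 hx).2)]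
    refine Finset.sum_congr rfl fun s hs => ?_
    rw [c_add, TensorProduct.sum_tmul]
    have : Finset.filter (fun x : ℕ × ℕ => x.1 + x.2 = s)
        ((Finset.range N ×ˢ Finset.range N).filter (fun x => x.1 + x.2 ∈ Finset.range N)) =
        Finset.HasAntidiagonal.antidiagonal s := by
      ext x
      simp at hs ⊢
      omega
    rw [this]
    refine Finset.sum_congr rfl fun x hx => ?_
    rw [Finset.HasAntidiagonal.mem_antidiagonal.1 hx]

theorem ε_c_one (m : ℕ) : ε (c 1 m) = if m = 1 then 1 else 0 := by
  match m with
  | 0 => simp [c_one_zero]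
  | 1 => rw [c_self]; simp
  | n + 2 => rw [c_one_succ, ε, lift_a]; simp

theorem ε_c (j : ℕ) : ∀ m, ε (c j m) = if m = j then 1 else 0 := by
  induction j with
  | zero => intro m; rw [c_zero]; split_ifs <;> simp
  | succ j ih =>
    intro m
    rw [c_add, map_sum]
    simp only [map_mul, ih, ε_c_one]
    by_cases h : m = j + 1
    · rw [if_pos h, Finset.sum_eq_single (j, 1)]
      · simp
      · rintro ⟨p, q⟩ hp hne
        by_cases h1 : p = j
        · have : q ≠ 1 := fun h2 => hne (by rw [h1, h2])
          simp [this]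
        · simp [h1]
      · intro hh; simp at hh; omega
    · rw [if_neg h]
      refine Finset.sum_eq_zero ?_
      rintro ⟨p, q⟩ hp
      rw [Finset.HasAntidiagonal.mem_antidiagonal] at hp
      simp at hp
      by_cases h1 : p = j
      · have : q ≠ 1 := fun h2 => h (by omega)
        simp [this]
      · simp [h1]

instance instBialgebra : Bialgebra ℂ Hdif :=
  Bialgebra.ofAlgHom Δ ε
    (by
      refine hom_ext fun n => ?_
      have h := Δ_c 1 (n + 2) (n + 3) (by omega)
      rw [c_one_succ] at h
      simp only [AlgHom.comp_apply, h, map_sum, Algebra.TensorProduct.map_tmul]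
      have l : ∀ x ∈ Finset.range (n + 3),
          (Algebra.TensorProduct.assoc ℂ ℂ ℂ Hdif Hdif Hdif).toAlgHom
            (Δ (c 1 x) ⊗ₜ[ℂ] (AlgHom.id ℂ Hdif) (c x (n + 2))) =
          ∑ i ∈ Finset.range (n + 3), c 1 i ⊗ₜ[ℂ] (c i x ⊗ₜ[ℂ] c x (n + 2)) := by
        intro x hx
        rw [Δ_c 1 x (n + 3) (by simpa using hx), TensorProduct.sum_tmul, map_sum]
        rfl
      have r : ∀ x ∈ Finset.range (n + 3),
          (AlgHom.id ℂ Hdif) (c 1 x) ⊗ₜ[ℂ] Δ (c x (n + 2)) =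
          ∑ i ∈ Finset.range (n + 3), c 1 x ⊗ₜ[ℂ] (c x i ⊗ₜ[ℂ] c i (n + 2)) := by
        intro x _
        rw [Δ_c x (n + 2) (n + 3) (by omega), TensorProduct.tmul_sum]
        rfl
      rw [Finset.sum_congr rfl l, Finset.sum_congr rfl r, Finset.sum_comm])
    (by
      refine hom_ext fun n => ?_
      have h := Δ_c 1 (n + 2) (n + 3) (by omega)
      rw [c_one_succ] at h
      simp only [AlgHom.comp_apply, h, map_sum, Algebra.TensorProduct.map_tmul, ε_c]
      rw [Finset.sum_eq_single 1]
      · simp [c_one_succ]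
      · intro b _ hb; simp [hb]
      · intro hh; simp at hh)
    (by
      refine hom_ext fun n => ?_
      have h := Δ_c 1 (n + 2) (n + 3) (by omega)
      rw [c_one_succ] at h
      simp only [AlgHom.comp_apply, h, map_sum, Algebra.TensorProduct.map_tmul, ε_c]
      rw [Finset.sum_eq_single (n + 2)]
      · simp [c_one_succ]
      · intro b _ hb; simp [hb.symm]
      · intro hh; simp at hh)

/-- The antipode on generators: `S a₀ = 1` and `S a_n = - ∑_{k < n} (S a_k) Q^{(k)}_{n-k}(a)`. -/
def Sgen : ℕ → Hdif
  | 0 => 1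
  | n + 1 => -∑ k : Fin (n + 1), Sgen k * c (k + 1) (n + 2)

/-- The antipode as an algebra map to the opposite algebra. -/
def Sop : Hdif →ₐ[ℂ] Hdifᵐᵒᵖ := lift fun n => MulOpposite.op (Sgen (n + 1))

/-- The antipode. -/
def S : Hdif →ₗ[ℂ] Hdif := unopLin Sop

theorem S_a (n : ℕ) : S (a n) = Sgen n := by
  match n with
  | 0 => rw [Sgen]; exact unopLin_one _
  | n + 1 => simp [S, unopLin, Sop, lift_a]

theorem left_antipode (x : Hdif) :
    LinearMap.mul' ℂ Hdif (S.rTensor Hdif (Δ x)) = algebraMap ℂ Hdif (ε x) := by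
  induction x using induction with
  | h0 r => simp [Algebra.TensorProduct.one_def, Algebra.algebraMap_eq_smul_one, S, unopLin_one]
  | h1 n =>
    have h := Δ_c 1 (n + 2) (n + 3) (by omega)
    rw [c_one_succ] at h
    have e : ε (a (n + 1)) = 0 := lift_a _ _
    rw [h, e, map_zero, map_sum, map_sum, Finset.sum_range_succ', Finset.sum_range_succ]
    simp only [LinearMap.rTensor_tmul, LinearMap.mul'_apply, c_one_succ, S_a, c_one_zero, map_zero,
      zero_mul, add_zero, c_self, mul_one]
    rw [Sgen, ← Fin.sum_univ_eq_sum_range (fun k => Sgen k * c (k + 1) (n + 2))]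
    exact add_neg_cancel _
  | hm x y hx hy => rw [map_mul, S, left_aux _ _ _ _ hx, ← S, hy, map_mul, map_mul]
  | ha x y hx hy => simp only [map_add, hx, hy]

theorem right_antipode (x : Hdif) :
    LinearMap.mul' ℂ Hdif (S.lTensor Hdif (Δ x)) = algebraMap ℂ Hdif (ε x) := by
  have left : ∀ i m N, m < N → ∑ k ∈ Finset.range N, S (c i k) * c k m =
      if m = i then 1 else 0 := by
    intro i m N h
    have := left_antipode (c i m)
    rw [Δ_c i m N h, ε_c] at this
    simp only [map_sum, LinearMap.rTensor_tmul, LinearMap.mul'_apply] at this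
    rw [this]; split_ifs <;> simp
  have right : ∀ i m N, m < N → ∑ k ∈ Finset.range N, c i k * S (c k m) =
      if m = i then 1 else 0 := by
    intro i m
    induction m using Nat.strong_induction_on with
    | _ m ih =>
      intro N h
      have e : ∑ l ∈ Finset.range (m + 1),
          (∑ k ∈ Finset.range N, c i k * S (c k l)) * c l m = c i m := by
        simp only [Finset.sum_mul, mul_assoc]
        rw [Finset.sum_comm]
        simp only [← Finset.mul_sum]
        rw [Finset.sum_congr rfl fun k _ => by rw [left k m (m + 1) (by omega)]]
        rw [Finset.sum_eq_single m]
        · simp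
        · intro b _ hb; simp [hb.symm]
        · intro hh; simp at hh; omega
      rw [Finset.sum_range_succ, c_self, mul_one] at e
      rw [Finset.sum_congr rfl fun l hl => by
        rw [ih l (by simpa using hl) N (by simp at hl; omega)]] at e
      by_cases hm : m = i
      · subst hm
        rw [Finset.sum_eq_zero, zero_add, c_self] at e
        · rw [e]; simp
        · intro l hl
          simp at hl
          simp [hl.ne]
      · rw [if_neg hm]
        by_cases hi : i < m
        · rw [Finset.sum_eq_single i] at e
          · simpa using e
          · intro b _ hb; simp [hb]
          · intro hh; simp at hh; omega
        · rw [Finset.sum_eq_zero, zero_add] at e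
          · rw [e, c_lt (by omega)]
          · intro l hl
            simp at hl
            rw [if_neg (by omega), zero_mul]
  induction x using induction with
  | h0 r => simp [Algebra.TensorProduct.one_def, Algebra.algebraMap_eq_smul_one, S, unopLin_one]
  | h1 n =>
    have h := Δ_c 1 (n + 2) (n + 3) (by omega)
    have e := right 1 (n + 2) (n + 3) (by omega)
    have e' := ε_c 1 (n + 2)
    rw [← c_one_succ, h, e']
    simp only [map_sum, LinearMap.lTensor_tmul, LinearMap.mul'_apply]
    rw [e]
    split_ifs <;> simp
  | hm x y hx hy =>
    rw [map_mul, S, right_aux _ _ _ _ hy, ← S, hx, map_mul ε, mul_comm (ε x),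
      map_mul]
  | ha x y hx hy => simp only [map_add, hx, hy]

instance instHopfAlgebra : HopfAlgebra ℂ Hdif where
  antipode := S
  mul_antipode_rTensor_comul := LinearMap.ext left_antipode
  mul_antipode_lTensor_comul := LinearMap.ext right_antipode

end Hdif

/-! ### The Hopf algebra on planar binary trees -/

/-- Rooted planar binary trees: `BinaryTree.nil` is the root tree `|` without internal vertices and
`BinaryTree.node () r s` is the grafting `r ∨ s` of `r` (left) and `s` (right) on a new root. -/
abbrev PBT : Type := BinaryTree Unit

namespace PBT

/-- The tree `t` over `s`: the root of `t` is grafted on the left-most leaf of `s`. -/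
def graftOver (t : PBT) : PBT → PBT
  | .nil => t
  | .node _ r s => .node () (graftOver t r) s

theorem nil_graftOver (s : PBT) : graftOver .nil s = s := by
  induction s with
  | nil => rfl
  | node _ r s hr _ => simp only [graftOver, hr]

theorem graftOver_assoc (t s u : PBT) : graftOver (graftOver t s) u = graftOver t (graftOver s u) := by
  induction u with
  | nil => rfl
  | node _ r v hr _ => simp only [graftOver, hr]

/-- The monoid of trees under the over product, with unit the root tree. -/
instance instMonoid : Monoid PBT where
  mul := graftOver
  one := .nil
  mul_assoc := graftOver_assoc
  one_mul := nil_graftOver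
  mul_one _ := rfl

theorem one_def : (1 : PBT) = .nil := rfl

theorem mul_node (t r s : PBT) : t * .node () r s = .node () (t * r) s := rfl

end PBT

/-- The vector space spanned by all planar binary trees, with the over product extended
bilinearly. -/
def Htree : Type := MonoidAlgebra ℂ PBT

namespace Htree

instance instRing : Ring Htree := inferInstanceAs (Ring (MonoidAlgebra ℂ PBT))
instance instAlgebra : Algebra ℂ Htree := inferInstanceAs (Algebra ℂ (MonoidAlgebra ℂ PBT))

/-- The basis element of a tree, as a monoid homomorphism. -/
def tree : PBT →* Htree := MonoidAlgebra.of ℂ PBT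

/-- Linear extension of a map defined on trees. -/
def linExt {M : Type*} [AddCommGroup M] [Module ℂ M] (f : PBT → M) : Htree →ₗ[ℂ] M :=
  Finsupp.linearCombination ℂ f ∘ₗ (MonoidAlgebra.coeffLinearEquiv ℂ).toLinearMap

theorem linExt_tree {M : Type*} [AddCommGroup M] [Module ℂ M] (f : PBT → M) (t : PBT) :
    linExt f (tree t) = f t := by
  show Finsupp.linearCombination ℂ f (Finsupp.single t 1) = f t
  simp

theorem lin_ext {M : Type*} [AddCommGroup M] [Module ℂ M] {f g : Htree →ₗ[ℂ] M}
    (h : ∀ t, f (tree t) = g (tree t)) : f = g :=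
  MonoidAlgebra.lhom_ext' fun t => LinearMap.ext_ring (h t)

theorem hom_ext {B : Type*} [Ring B] [Algebra ℂ B] {f g : Htree →ₐ[ℂ] B}
    (h : ∀ t, f (tree t) = g (tree t)) : f = g :=
  AlgHom.toLinearMap_injective (lin_ext h)

/-- The algebra map extending a multiplicative map on trees. -/
def lift {B : Type*} [Ring B] [Algebra ℂ B] (f : PBT →* B) : Htree →ₐ[ℂ] B :=
  MonoidAlgebra.lift ℂ B PBT f

theorem lift_tree {B : Type*} [Ring B] [Algebra ℂ B] (f : PBT →* B) (t : PBT) :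
    lift f (tree t) = f t := MonoidAlgebra.lift_of f t

/-- The linear map `V`, with `V(t) = | ∨ t` on trees. -/
def V : Htree →ₗ[ℂ] Htree := linExt fun t => tree (.node () .nil t)

theorem V_tree (t : PBT) : V (tree t) = tree (.node () .nil t) := linExt_tree _ t

/-- The values on a tree of the co-product `Δ` (first component) and of the co-action `δ`
(second component), defined by simultaneous recursion:
`Δ | = δ | = | ⊗ |`, `Δ (r ∨ s) = Δ r / Δ V(s)`, `δ (r ∨ s) = Δ r / δ V(s)`, where
`δ V(s) = (V ⊗ Id) δ s` and `Δ V(s) = | ⊗ V(s) + δ V(s)`. -/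
def coprods : PBT → (Htree ⊗[ℂ] Htree) × (Htree ⊗[ℂ] Htree)
  | .nil => (1 ⊗ₜ 1, 1 ⊗ₜ 1)
  | .node _ r s =>
    ((coprods r).1 * (1 ⊗ₜ V (tree s) + V.rTensor Htree (coprods s).2),
      (coprods r).1 * V.rTensor Htree (coprods s).2)

theorem coprods_mul (t s : PBT) : (coprods (t * s)).1 = (coprods t).1 * (coprods s).1 := by
  induction s with
  | nil =>
    rw [← PBT.one_def, mul_one, PBT.one_def, coprods, ← Algebra.TensorProduct.one_def, mul_one]
  | node _ r u hr _ => rw [PBT.mul_node]; simp only [coprods, hr, mul_assoc]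

/-- The co-product `Δ^α`. -/
def Δ : Htree →ₐ[ℂ] Htree ⊗[ℂ] Htree := lift
  { toFun := fun t => (coprods t).1
    map_one' := rfl
    map_mul' := coprods_mul }

/-- The right co-action `δ^α`. -/
def δ : Htree →ₗ[ℂ] Htree ⊗[ℂ] Htree := linExt fun t => (coprods t).2

/-- The co-unit: `1` on the root tree and `0` on all other trees. -/
def ε : Htree →ₐ[ℂ] ℂ := lift
  { toFun := fun t => match t with
      | .nil => 1
      | .node _ _ _ => 0
    map_one' := rfl
    map_mul' := by
      intro t s
      cases s with
      | nil => rw [← PBT.one_def, mul_one]; exact (mul_one _).symm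
      | node _ r u => rw [PBT.mul_node]; exact (mul_zero _).symm }

theorem Δ_tree (t : PBT) : Δ (tree t) = (coprods t).1 := lift_tree _ t

theorem δ_tree (t : PBT) : δ (tree t) = (coprods t).2 := linExt_tree _ t

theorem ε_nil : ε (tree .nil) = 1 := lift_tree _ _

theorem ε_node (r s : PBT) : ε (tree (.node () r s)) = 0 := lift_tree _ _

/-! The defining recursive formulae. -/

theorem Δ_nil : Δ (tree .nil) = tree .nil ⊗ₜ tree .nil := Δ_tree _

theorem δ_nil : δ (tree .nil) = tree .nil ⊗ₜ tree .nil := δ_tree _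

theorem δ_V (r : PBT) : δ (V (tree r)) = V.rTensor Htree (δ (tree r)) := by
  rw [V_tree, δ_tree, δ_tree, coprods, coprods, ← Algebra.TensorProduct.one_def]
  exact one_mul _

theorem Δ_V (r : PBT) : Δ (V (tree r)) = tree .nil ⊗ₜ V (tree r) + δ (V (tree r)) := by
  rw [δ_V, V_tree, Δ_tree, δ_tree, coprods, coprods, ← Algebra.TensorProduct.one_def, one_mul,
    V_tree]
  rfl

theorem δ_node (r s : PBT) :
    δ (tree (.node () r s)) = Δ (tree r) * δ (V (tree s)) := by
  rw [δ_V, δ_tree, δ_tree, Δ_tree, coprods]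

theorem tree_node (r s : PBT) : tree (.node () r s) = tree r * V (tree s) := by
  rw [V_tree, ← map_mul, PBT.mul_node, ← PBT.one_def, mul_one]

theorem Δ_node (r s : PBT) :
    Δ (tree (.node () r s)) = Δ (tree r) * Δ (V (tree s)) := by
  rw [tree_node, map_mul]

theorem tree_nil : tree .nil = 1 := map_one tree

theorem δ_one : δ 1 = 1 := by rw [← tree_nil, δ_nil, tree_nil, Algebra.TensorProduct.one_def]

/-! Co-associativity, co-unit and antipode. -/

theorem δ_comp_V : δ ∘ₗ V = V.rTensor Htree ∘ₗ δ := lin_ext δ_V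

theorem δ_mul_V (x y : Htree) : δ (x * V y) = Δ x * δ (V y) := by
  have h : ((LinearMap.mul ℂ Htree).compl₂ V).compr₂ δ =
      (LinearMap.mul ℂ (Htree ⊗[ℂ] Htree)).compl₁₂ Δ.toLinearMap (δ ∘ₗ V) := by
    refine lin_ext fun t => lin_ext fun s => ?_
    simp only [LinearMap.compr₂_apply, LinearMap.compl₂_apply, LinearMap.compl₁₂_apply,
      LinearMap.mul_apply', AlgHom.toLinearMap_apply, LinearMap.comp_apply]
    rw [← tree_node, δ_node]
  exact congrArg (fun f => f x y) h

/-- `(Δ ⊗ Id) w`, re-associated. -/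
abbrev ΔL : Htree ⊗[ℂ] Htree →ₐ[ℂ] Htree ⊗[ℂ] (Htree ⊗[ℂ] Htree) :=
  (Algebra.TensorProduct.assoc ℂ ℂ ℂ Htree Htree Htree).toAlgHom.comp
    (Algebra.TensorProduct.map Δ (.id ℂ Htree))

/-- `(δ ⊗ Id) w`, re-associated. -/
abbrev δL : Htree ⊗[ℂ] Htree →ₗ[ℂ] Htree ⊗[ℂ] (Htree ⊗[ℂ] Htree) :=
  (TensorProduct.assoc ℂ Htree Htree Htree).toLinearMap ∘ₗ δ.rTensor Htree

/-- `(Id ⊗ Δ) w`. -/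
abbrev ΔR : Htree ⊗[ℂ] Htree →ₐ[ℂ] Htree ⊗[ℂ] (Htree ⊗[ℂ] Htree) :=
  Algebra.TensorProduct.map (.id ℂ Htree) Δ

theorem δL_mul (w v : Htree ⊗[ℂ] Htree) :
    δL (w * V.rTensor Htree v) = ΔL w * δL (V.rTensor Htree v) := by
  induction w with
  | zero => simp
  | add w₁ w₂ h₁ h₂ => simp only [add_mul, map_add, h₁, h₂]
  | tmul w₁ w₂ =>
    induction v with
    | zero => simp
    | add v₁ v₂ h₁ h₂ => simp only [mul_add, map_add, h₁, h₂]
    | tmul v₁ v₂ =>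
      have e : ∀ z : Htree ⊗[ℂ] Htree, ∀ y : Htree,
          (TensorProduct.assoc ℂ Htree Htree Htree) (z ⊗ₜ y) =
          (Algebra.TensorProduct.assoc ℂ ℂ ℂ Htree Htree Htree).toAlgHom (z ⊗ₜ y) :=
        fun _ _ => rfl
      simp only [LinearMap.rTensor_tmul, Algebra.TensorProduct.tmul_mul_tmul,
        LinearMap.comp_apply, LinearEquiv.coe_coe, δ_mul_V, AlgHom.comp_apply, e,
        Algebra.TensorProduct.map_tmul, AlgHom.id_apply, ← map_mul]

theorem δL_V (w : Htree ⊗[ℂ] Htree) :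
    δL (V.rTensor Htree w) = V.rTensor (Htree ⊗[ℂ] Htree) (δL w) := by
  induction w with
  | zero => simp
  | add w₁ w₂ h₁ h₂ => simp only [map_add, h₁, h₂]
  | tmul x y =>
    have h : δ (V x) = V.rTensor Htree (δ x) := congrArg (fun f => f x) δ_comp_V
    simp only [LinearMap.rTensor_tmul, LinearMap.comp_apply, LinearEquiv.coe_coe, h]
    induction δ x with
    | zero => simp
    | add w₁ w₂ h₁ h₂ => simp only [map_add, TensorProduct.add_tmul, h₁, h₂]
    | tmul x y => simp

theorem ΔR_V (w : Htree ⊗[ℂ] Htree) :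
    ΔR (V.rTensor Htree w) = V.rTensor (Htree ⊗[ℂ] Htree) (ΔR w) := by
  induction w with
  | zero => simp
  | add w₁ w₂ h₁ h₂ => simp only [map_add, h₁, h₂]
  | tmul x y => simp

theorem ΔL_V (w : Htree ⊗[ℂ] Htree) :
    ΔL (V.rTensor Htree w) = 1 ⊗ₜ V.rTensor Htree w + δL (V.rTensor Htree w) := by
  induction w with
  | zero => simp
  | add w₁ w₂ h₁ h₂ =>
    simp only [map_add, h₁, h₂, TensorProduct.tmul_add]
    abel
  | tmul x y =>
    have h : Δ.toLinearMap ∘ₗ V = (TensorProduct.mk ℂ Htree Htree 1) ∘ₗ V + δ ∘ₗ V :=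
      lin_ext fun t => by
        simpa [tree_nil] using Δ_V t
    have h' : Δ (V x) = 1 ⊗ₜ V x + δ (V x) := congrArg (fun f => f x) h
    simp only [AlgHom.comp_apply, LinearMap.comp_apply, LinearMap.rTensor_tmul,
      Algebra.TensorProduct.map_tmul, h', TensorProduct.add_tmul, map_add]
    rfl

theorem coassoc_aux (t : PBT) :
    ΔL (Δ (tree t)) = ΔR (Δ (tree t)) ∧ δL (δ (tree t)) = ΔR (δ (tree t)) := by
  induction t with
  | nil =>
    constructor
    · rw [tree_nil]; simp only [map_one]
    · rw [δ_nil, tree_nil]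
      have h : δ 1 = 1 ⊗ₜ 1 := by rw [← tree_nil, δ_nil]
      simp [h, Algebra.TensorProduct.one_def]
  | node _ r s hr hs =>
    have h1 : δL (δ (V (tree s))) = ΔR (δ (V (tree s))) := by
      rw [δ_V, δL_V, hs.2, ΔR_V]
    constructor
    · rw [Δ_node, map_mul, map_mul, hr.1]
      congr 1
      rw [Δ_V, map_add, map_add, ← h1, δ_V, ΔL_V, tree_nil, ← δ_V]
      simp only [AlgHom.comp_apply, Algebra.TensorProduct.map_tmul, map_one, AlgHom.id_apply, Δ_V,
        TensorProduct.tmul_add, tree_nil, Algebra.TensorProduct.one_def]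
      rw [add_assoc]
      rfl
    · rw [δ_node, map_mul ΔR, ← h1, ← hr.1, δ_V, δL_mul]

/-- `δ` is a right co-action: `(δ ⊗ Id) δ = (Id ⊗ Δ) δ`. -/
theorem δ_coaction (x : Htree) :
    TensorProduct.assoc ℂ Htree Htree Htree (δ.rTensor Htree (δ x)) =
      Δ.toLinearMap.lTensor Htree (δ x) := by
  have : δL ∘ₗ δ = ΔR.toLinearMap ∘ₗ δ := lin_ext fun t => (coassoc_aux t).2
  exact congrArg (fun f => f x) this

theorem counit_aux (t : PBT) :
    (Algebra.TensorProduct.map (.id ℂ Htree) ε) (Δ (tree t)) = tree t ⊗ₜ 1 ∧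
      (Algebra.TensorProduct.map (.id ℂ Htree) ε) (δ (tree t)) = tree t ⊗ₜ 1 := by
  have hV : ∀ w : Htree ⊗[ℂ] Htree, (Algebra.TensorProduct.map (.id ℂ Htree) ε)
      (V.rTensor Htree w) = V.rTensor ℂ ((Algebra.TensorProduct.map (.id ℂ Htree) ε) w) := by
    intro w
    induction w with
    | zero => simp
    | add w₁ w₂ h₁ h₂ => simp only [map_add, h₁, h₂]
    | tmul x y => simp
  induction t with
  | nil => simp [Δ_nil, δ_nil, ε_nil]
  | node _ r s hr hs =>
    rw [Δ_node, δ_node, map_mul, map_mul, hr.1, Δ_V, map_add, δ_V, hV, hs.2, V_tree]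
    simp [ε_node, tree_node r s, V_tree]

theorem ε_V (x : Htree) : ε (V x) = 0 := by
  have : ε.toLinearMap ∘ₗ V = 0 := lin_ext fun t => by simp [V_tree, ε_node]
  exact congrArg (fun f => f x) this

theorem counit_aux' (t : PBT) :
    (Algebra.TensorProduct.map ε (.id ℂ Htree)) (Δ (tree t)) = 1 ⊗ₜ tree t := by
  have hV : ∀ w : Htree ⊗[ℂ] Htree, (Algebra.TensorProduct.map ε (.id ℂ Htree))
      (V.rTensor Htree w) = 0 := by
    intro w
    induction w with
    | zero => simp
    | add w₁ w₂ h₁ h₂ => simp only [map_add, h₁, h₂, add_zero]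
    | tmul x y => simp [ε_V]
  induction t with
  | nil => simp [Δ_nil, ε_nil]
  | node _ r s hr _ =>
    rw [Δ_node, map_mul, hr, Δ_V, map_add, δ_V, hV]
    simp [ε_nil, tree_node r s]

instance instBialgebra : Bialgebra ℂ Htree :=
  Bialgebra.ofAlgHom Δ ε (hom_ext fun t => (coassoc_aux t).1) (hom_ext counit_aux')
    (hom_ext fun t => (counit_aux t).1)

/-- For `w = ∑ x ⊗ y` in `H ⊗ Hᵒᵖ`, the element `∑ x * y`. -/
def mulOp : Htree ⊗[ℂ] Htreeᵐᵒᵖ →ₗ[ℂ] Htree :=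
  LinearMap.mul' ℂ Htree ∘ₗ (MulOpposite.opLinearEquiv ℂ).symm.toLinearMap.lTensor Htree

/-- Simultaneous recursion for `(Id ⊗ S) Δ`, `(Id ⊗ S) δ` and the antipode `S`, the latter as an
anti-homomorphism, with `S V(s) = - m (Id ⊗ S) δ V(s)`. -/
def antipodeAux : PBT →
    (Htree ⊗[ℂ] Htreeᵐᵒᵖ) × (Htree ⊗[ℂ] Htreeᵐᵒᵖ) × Htreeᵐᵒᵖ
  | .nil => (1, 1, 1)
  | .node _ r s =>
    let w := V.rTensor Htreeᵐᵒᵖ (antipodeAux s).2.1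
    let v := -MulOpposite.op (mulOp w)
    ((antipodeAux r).1 * (1 ⊗ₜ v + w), (antipodeAux r).1 * w, (antipodeAux r).2.2 * v)

theorem antipodeAux_mul (t s : PBT) :
    (antipodeAux (t * s)).2.2 = (antipodeAux t).2.2 * (antipodeAux s).2.2 := by
  induction s with
  | nil => rw [← PBT.one_def, mul_one, PBT.one_def, antipodeAux, mul_one]
  | node _ r u hr _ => rw [PBT.mul_node]; simp only [antipodeAux, hr, mul_assoc]

/-- The antipode as an algebra map to the opposite algebra. -/
def Sop : Htree →ₐ[ℂ] Htreeᵐᵒᵖ := lift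
  { toFun := fun t => (antipodeAux t).2.2
    map_one' := rfl
    map_mul' := antipodeAux_mul }

/-- The antipode. -/
def S : Htree →ₗ[ℂ] Htree := unopLin Sop

theorem Sop_V (s : PBT) : Sop (V (tree s)) =
    -MulOpposite.op (mulOp (V.rTensor Htreeᵐᵒᵖ (antipodeAux s).2.1)) := by
  rw [V_tree]
  refine (lift_tree _ _).trans ?_
  exact one_mul (M := Htreeᵐᵒᵖ) _

theorem antipodeAux_eq (t : PBT) :
    Algebra.TensorProduct.map (.id ℂ Htree) Sop (Δ (tree t)) = (antipodeAux t).1 ∧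
      Algebra.TensorProduct.map (.id ℂ Htree) Sop (δ (tree t)) = (antipodeAux t).2.1 := by
  have hV : ∀ w : Htree ⊗[ℂ] Htree, (Algebra.TensorProduct.map (.id ℂ Htree) Sop)
      (V.rTensor Htree w) =
      V.rTensor Htreeᵐᵒᵖ ((Algebra.TensorProduct.map (.id ℂ Htree) Sop) w) := by
    intro w
    induction w with
    | zero => simp
    | add w₁ w₂ h₁ h₂ => simp only [map_add, h₁, h₂]
    | tmul x y => simp
  induction t with
  | nil => simp [tree_nil, δ_one, antipodeAux]
  | node _ r s hr hs =>
    rw [Δ_node, δ_node, map_mul, map_mul, hr.1, Δ_V, map_add, δ_V, hV, hs.2]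
    simp [antipodeAux, Sop_V, tree_nil]

theorem right_antipode (x : Htree) :
    LinearMap.mul' ℂ Htree (S.lTensor Htree (Δ x)) = algebraMap ℂ Htree (ε x) := by
  have h0 : ∀ w : Htree ⊗[ℂ] Htree, LinearMap.mul' ℂ Htree (S.lTensor Htree w) =
      mulOp (Algebra.TensorProduct.map (.id ℂ Htree) Sop w) := by
    intro w
    induction w with
    | zero => simp
    | add w₁ w₂ h₁ h₂ => simp only [map_add, h₁, h₂]
    | tmul x y => simp [mulOp, S, unopLin]
  have h : LinearMap.mul' ℂ Htree ∘ₗ S.lTensor Htree ∘ₗ Δ.toLinearMap =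
      Algebra.linearMap ℂ Htree ∘ₗ ε.toLinearMap := by
    refine lin_ext fun t => ?_
    simp only [LinearMap.comp_apply, AlgHom.toLinearMap_apply, Algebra.linearMap_apply]
    cases t with
    | nil => simp [tree_nil, S, unopLin_one, Algebra.TensorProduct.one_def]
    | node _ r s =>
      have hV : LinearMap.mul' ℂ Htree (S.lTensor Htree (Δ (V (tree s)))) =
          algebraMap ℂ Htree 0 := by
        rw [h0]
        have e := (antipodeAux_eq (.node () .nil s)).1
        rw [V_tree, e]
        have e2 := Sop_V s
        simp [antipodeAux, mulOp]
      rw [Δ_node, S, right_aux _ _ _ _ hV, ε_node]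
      simp
  exact congrArg (fun f => f x) h

/-- The convolution product of the antipode with the identity. -/
def X : Htree →ₗ[ℂ] Htree := LinearMap.mul' ℂ Htree ∘ₗ S.rTensor Htree ∘ₗ Δ.toLinearMap

theorem mul_X (x : Htree) : LinearMap.mul' ℂ Htree (X.lTensor Htree (Δ x)) = x := by
  have h : WithConv.toConv (LinearMap.id (R := ℂ) (M := Htree)) * WithConv.toConv S = 1 := by
    ext x
    exact right_antipode x
  have h2 : WithConv.toConv (LinearMap.id (R := ℂ) (M := Htree)) * (WithConv.toConv S *
      WithConv.toConv (LinearMap.id (R := ℂ) (M := Htree))) =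
      WithConv.toConv (LinearMap.id (R := ℂ) (M := Htree)) := by
    rw [← mul_assoc, h, one_mul]
  exact congrArg (fun f => f.ofConv x) h2

theorem lTensor_X_mul (u : Htree) (v w : Htree ⊗[ℂ] Htree) (h : X.lTensor Htree v = u ⊗ₜ 1) :
    X.lTensor Htree (v * w) = (u ⊗ₜ 1) * X.lTensor Htree w := by
  induction w with
  | zero => simp
  | add w₁ w₂ h₁ h₂ => simp only [mul_add, map_add, h₁, h₂]
  | tmul w₁ w₂ =>
    have key : X.lTensor Htree (v * (w₁ ⊗ₜ w₂)) =
        TensorProduct.map (LinearMap.mulRight ℂ w₁) (LinearMap.mul' ℂ Htree ∘ₗ S.rTensor Htree ∘ₗ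
          LinearMap.mulRight ℂ (Δ w₂) ∘ₗ TensorProduct.mk ℂ Htree Htree 1)
          (X.lTensor Htree v) := by
      clear h
      induction v with
      | zero => simp
      | add v₁ v₂ h₁ h₂ => simp only [add_mul, map_add, h₁, h₂]
      | tmul v₁ v₂ =>
        have e : X (v₂ * w₂) =
            LinearMap.mul' ℂ Htree (S.rTensor Htree ((1 ⊗ₜ X v₂) * Δ w₂)) := by
          simp only [X, LinearMap.comp_apply, AlgHom.toLinearMap_apply, map_mul]
          exact left_gen Sop _ _
        simp [e]
    rw [key, h, TensorProduct.map_tmul]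
    simp [X, ← Algebra.TensorProduct.one_def]

theorem X_aux (t : PBT) : X.lTensor Htree (Δ (tree t)) = tree t ⊗ₜ 1 ∧
    X.lTensor Htree (δ (tree t)) = tree t ⊗ₜ 1 ∧
    X (tree t) = algebraMap ℂ Htree (ε (tree t)) := by
  have hV : ∀ w : Htree ⊗[ℂ] Htree, X.lTensor Htree (V.rTensor Htree w) =
      V.rTensor Htree (X.lTensor Htree w) := by
    intro w
    induction w with
    | zero => simp
    | add w₁ w₂ h₁ h₂ => simp only [map_add, h₁, h₂]
    | tmul x y => simp
  have hX1 : X 1 = 1 := by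
    simp [X, Algebra.TensorProduct.one_def, S, unopLin_one]
  induction t with
  | nil => simp [tree_nil, δ_one, Algebra.TensorProduct.one_def, hX1]
  | node _ r s hr hs =>
    have h1 : X.lTensor Htree (δ (V (tree s))) = V (tree s) ⊗ₜ 1 := by
      rw [δ_V, hV, hs.2.1, LinearMap.rTensor_tmul]
    have h2 : X (V (tree s)) = 0 := by
      have := mul_X (V (tree s))
      rw [Δ_V, map_add, h1, tree_nil] at this
      simpa using this
    refine ⟨?_, ?_, ?_⟩
    · rw [Δ_node, lTensor_X_mul _ _ _ hr.1, Δ_V, map_add, h1, LinearMap.lTensor_tmul, h2]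
      simp only [TensorProduct.tmul_zero, zero_add,
        Algebra.TensorProduct.tmul_mul_tmul, mul_one]
      exact congrArg (fun z => z ⊗ₜ[ℂ] (1 : Htree)) (tree_node r s).symm
    · rw [δ_node, lTensor_X_mul _ _ _ hr.1, h1]
      simp only [Algebra.TensorProduct.tmul_mul_tmul, mul_one]
      exact congrArg (fun z => z ⊗ₜ[ℂ] (1 : Htree)) (tree_node r s).symm
    · rw [ε_node, map_zero]
      have e := left_aux Sop (Δ (tree r)) (Δ (V (tree s))) _ hr.2.2
      have e' : LinearMap.mul' ℂ Htree ((unopLin Sop).rTensor Htree (Δ (V (tree s)))) = 0 := h2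
      rw [e', mul_zero, ← Δ_node] at e
      exact e

theorem left_antipode (x : Htree) :
    LinearMap.mul' ℂ Htree (S.rTensor Htree (Δ x)) = algebraMap ℂ Htree (ε x) := by
  have h : X = Algebra.linearMap ℂ Htree ∘ₗ ε.toLinearMap := lin_ext fun t => (X_aux t).2.2
  exact congrArg (fun f => f x) h

instance instHopfAlgebra : HopfAlgebra ℂ Htree where
  antipode := S
  mul_antipode_rTensor_comul := LinearMap.ext left_antipode
  mul_antipode_lTensor_comul := LinearMap.ext right_antipode

/-- `t_n`, the sum of all planar binary trees with `n` internal vertices. -/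
def t (n : ℕ) : Htree := ∑ s ∈ BinaryTree.treesOfNumNodesEq n, tree s

end Htree

/-- The homomorphism of unital algebras with `Ω a_n = t_n` for `n ≥ 1`. -/
def Ω : Hdif →ₐ[ℂ] Htree := Hdif.lift fun n => Htree.t (n + 1)

end NCDiff

end

open NCDiff

noncomputable section

namespace NCDiff

/-! ### Homomorphisms of bialgebras between Hopf algebras -/

theorem antipode_bialgHom_apply {R A B : Type*} [CommSemiring R] [Semiring A] [Semiring B]
    [HopfAlgebra R A] [HopfAlgebra R B] (f : A →ₐc[R] B) (x : A) :
    HopfAlgebra.antipode R (f x) = f (HopfAlgebra.antipode R x) := by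
  have h₁ : WithConv.toConv ((f : A →ₐ[R] B).toLinearMap ∘ₗ HopfAlgebra.antipode R) *
      WithConv.toConv (f : A →ₐ[R] B).toLinearMap = 1 := by
    have h := LinearMap.algHom_comp_convMul_distrib (f : A →ₐ[R] B)
      (WithConv.toConv (HopfAlgebra.antipode R (A := A))) (WithConv.toConv LinearMap.id)
    rw [LinearMap.antipode_mul_id] at h
    refine (congrArg WithConv.toConv h).symm.trans ?_
    ext y
    exact (f : A →ₐ[R] B).commutes _
  have h₂ : WithConv.toConv (f : A →ₐ[R] B).toLinearMap *
      WithConv.toConv (HopfAlgebra.antipode R ∘ₗ (f : A →ₐ[R] B).toLinearMap) = 1 := by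
    have h := LinearMap.convMul_comp_coalgHom_distrib (WithConv.toConv LinearMap.id)
      (WithConv.toConv (HopfAlgebra.antipode R (A := B))) (f : A →ₗc[R] B)
    rw [LinearMap.id_mul_antipode] at h
    refine (congrArg WithConv.toConv h).symm.trans ?_
    ext y
    exact congrArg (algebraMap R B) (CoalgHomClass.counit_comp_apply f y)
  have h := left_inv_eq_right_inv h₁ h₂
  exact (congrArg (fun g => g.ofConv x) h).symm

theorem isHopfSubalgebra_range {A B : Type*} [Ring A] [Ring B] [HopfAlgebra ℂ A]
    [HopfAlgebra ℂ B] (f : A →ₐc[ℂ] B) : IsHopfSubalgebra (f : A →ₐ[ℂ] B).range := by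
  refine ⟨?_, ?_⟩
  · rintro _ ⟨x, rfl⟩
    have h : Coalgebra.comul (R := ℂ) (f x) =
        TensorProduct.map (f : A →ₐ[ℂ] B).toLinearMap (f : A →ₐ[ℂ] B).toLinearMap
          (Coalgebra.comul (R := ℂ) x) :=
      (CoalgHomClass.map_comp_comul_apply f x).symm
    have e : (f : A →ₐ[ℂ] B).toLinearMap = (f : A →ₐ[ℂ] B).range.val.toLinearMap ∘ₗ
        (f : A →ₐ[ℂ] B).rangeRestrict.toLinearMap := rfl
    rw [e, TensorProduct.map_comp] at h
    exact ⟨_, h.symm⟩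
  · rintro _ ⟨x, rfl⟩
    exact ⟨_, (antipode_bialgHom_apply f x).symm⟩

/-! ### The polynomials `Q` as coefficients of powers -/

theorem sum_antidiagonalTuple_succ {M : Type*} [AddCommMonoid M] (k n : ℕ)
    (f : (Fin (k + 1) → ℕ) → M) :
    ∑ x ∈ Finset.Nat.antidiagonalTuple (k + 1) n, f x =
      ∑ p ∈ Finset.HasAntidiagonal.antidiagonal n,
        ∑ x ∈ Finset.Nat.antidiagonalTuple k p.2, f (Fin.cons p.1 x) := by
  rw [Finset.sum_sigma']
  refine Finset.sum_bij' (fun x _ => ⟨(x 0, ∑ i, Fin.tail x i), Fin.tail x⟩)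
    (fun y _ => Fin.cons y.1.1 y.2) ?_ ?_ ?_ ?_ ?_
  · intro x hx
    rw [Finset.Nat.mem_antidiagonalTuple, Fin.sum_univ_succ] at hx
    simpa [Finset.Nat.mem_antidiagonalTuple, Fin.tail] using hx
  · rintro ⟨⟨i, j⟩, x⟩ hx
    simp only [Finset.mem_sigma, Finset.HasAntidiagonal.mem_antidiagonal,
      Finset.Nat.mem_antidiagonalTuple] at hx
    simp [Finset.Nat.mem_antidiagonalTuple, Fin.sum_univ_succ, hx]
  · intro x _
    exact Fin.cons_self_tail x
  · rintro ⟨⟨i, j⟩, x⟩ hx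
    simp only [Finset.mem_sigma, Finset.Nat.mem_antidiagonalTuple] at hx
    simp [hx.2]
  · intro x _
    rw [Fin.cons_self_tail]

theorem Qpoly_eq_coeff_pow {R : Type*} [Semiring R] (c : ℕ → R) (N m : ℕ) :
    Qpoly c N m = PowerSeries.coeff m (PowerSeries.mk c ^ N) := by
  induction N generalizing m with
  | zero => cases m <;> simp [Qpoly, PowerSeries.coeff_one]
  | succ N ih =>
    rw [Qpoly, sum_antidiagonalTuple_succ, pow_succ', PowerSeries.coeff_mul]
    refine Finset.sum_congr rfl fun p _ => ?_
    rw [← ih, Qpoly, PowerSeries.coeff_mk, Finset.mul_sum]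
    simp

theorem map_Qpoly {R S F : Type*} [Semiring R] [Semiring S] [FunLike F R S]
    [RingHomClass F R S] (f : F) (c : ℕ → R) (N m : ℕ) :
    f (Qpoly c N m) = Qpoly (fun n => f (c n)) N m := by
  simp only [Qpoly, map_sum, map_list_prod, List.map_ofFn, Function.comp_def]

namespace Hdif

theorem c_add_right (N m : ℕ) : c N (N + m) = Qpoly a N m := by
  have h : A = PowerSeries.X * PowerSeries.mk a := by
    ext n
    cases n with
    | zero => simp [A]
    | succ n => rw [PowerSeries.coeff_succ_X_mul, A, PowerSeries.coeff_mk, PowerSeries.coeff_mk]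
  rw [c, h, (PowerSeries.commute_X (PowerSeries.mk a)).symm.mul_pow, Qpoly_eq_coeff_pow, add_comm,
    PowerSeries.coeff_X_pow_mul]

end Hdif

theorem Ω_a (n : ℕ) : Ω (Hdif.a n) = Htree.t n := by
  cases n with
  | zero => simp [Hdif.a, Htree.t, Htree.tree_nil]
  | succ n => exact Hdif.lift_a _ n

theorem Ω_c (k n : ℕ) (h : k ≤ n) : Ω (Hdif.c k n) = Qpoly Htree.t k (n - k) := by
  obtain ⟨m, rfl⟩ := Nat.exists_eq_add_of_le h
  rw [Hdif.c_add_right, map_Qpoly, Nat.add_sub_cancel_left]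
  simp only [Ω_a]

theorem Ω_c_one_succ (n : ℕ) : Ω (Hdif.c 1 (n + 1)) = Htree.t n := by
  rw [Hdif.c_one_succ, Ω_a]

namespace Htree

open BinaryTree in
theorem sum_treesOfNumNodesEq_succ {M : Type*} [AddCommMonoid M] (n : ℕ) (f : PBT → M) :
    ∑ s ∈ treesOfNumNodesEq (n + 1), f s = ∑ p ∈ Finset.HasAntidiagonal.antidiagonal n,
      ∑ r ∈ treesOfNumNodesEq p.1, ∑ s ∈ treesOfNumNodesEq p.2, f (.node () r s) := by
  rw [treesOfNumNodesEq_succ, Finset.sum_biUnion]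
  · refine Finset.sum_congr rfl fun p _ => ?_
    rw [Finset.sum_map, Finset.sum_product]
    rfl
  · simp_rw [Set.PairwiseDisjoint, Set.Pairwise, Finset.disjoint_left]
    aesop

theorem t_zero : t 0 = 1 := by simp [t, tree_nil]

theorem t_succ (n : ℕ) :
    t (n + 1) = ∑ p ∈ Finset.HasAntidiagonal.antidiagonal n, t p.1 * V (t p.2) := by
  rw [t, sum_treesOfNumNodesEq_succ]
  refine Finset.sum_congr rfl fun p _ => ?_
  rw [t, t, map_sum, Finset.sum_mul_sum]
  simp only [tree_node]

theorem Δ_V_apply (x : Htree) : Δ (V x) = 1 ⊗ₜ V x + δ (V x) := by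
  have h : Δ.toLinearMap ∘ₗ V = (TensorProduct.mk ℂ Htree Htree 1) ∘ₗ V + δ ∘ₗ V :=
    lin_ext fun t => by simpa [tree_nil] using Δ_V t
  exact congrArg (fun f => f x) h

theorem δ_V_apply (x : Htree) : δ (V x) = V.rTensor Htree (δ x) :=
  congrArg (fun f => f x) δ_comp_V

end Htree

open Htree

theorem Ω_c_zero_right (k : ℕ) : Ω (Hdif.c (k + 1) 0) = 0 := by
  rw [Hdif.c_lt (Nat.succ_pos k), map_zero]

/-- The recursion `T^{k+1} = T^k + x T^{k+1} V(T)` for the series `T = ∑ t_n x^n`. -/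
theorem Ω_c_succ (k n : ℕ) : Ω (Hdif.c (k + 1) (n + 2)) = Ω (Hdif.c k (n + 1)) +
    ∑ p ∈ Finset.HasAntidiagonal.antidiagonal n, Ω (Hdif.c (k + 1) (p.1 + 1)) * V (t p.2) := by
  have h (m : ℕ) : Ω (Hdif.c (k + 1) (m + 1)) =
      ∑ p ∈ Finset.HasAntidiagonal.antidiagonal m, Ω (Hdif.c k p.1) * t p.2 := by
    rw [Hdif.c_add, map_sum, Finset.Nat.sum_antidiagonal_succ']
    simp only [map_mul, Hdif.c_one_zero, map_zero, mul_zero, zero_add, Ω_c_one_succ]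
  rw [h, Finset.Nat.sum_antidiagonal_succ', t_zero, mul_one]
  congr 1
  simp only [h, t_succ, Finset.mul_sum, Finset.sum_mul, Finset.sum_sigma']
  refine Finset.sum_bij' (fun x _ => ⟨(x.1.1 + x.2.1, x.2.2), (x.1.1, x.2.1)⟩)
    (fun x _ => ⟨(x.2.1, x.2.2 + x.1.2), (x.2.2, x.1.2)⟩) ?_ ?_ ?_ ?_ ?_
  all_goals
    rintro ⟨⟨i, j⟩, ⟨l, m⟩⟩ hx
    simp only [Finset.mem_sigma, Finset.HasAntidiagonal.mem_antidiagonal] at hx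
    obtain ⟨h₁, h₂⟩ := hx
  · simp; omega
  · simp; omega
  · simp; omega
  · simp; omega
  · simp only [mul_assoc]

theorem sum_t_mul_V_tmul (n N : ℕ) (hN : n < N) :
    ∑ k ∈ Finset.range N, ∑ l ∈ Finset.range N,
      (t k * V (t l)) ⊗ₜ[ℂ] Ω (Hdif.c (k + 1 + l) (n + 1)) =
    ∑ k ∈ Finset.range (N + 1), t k ⊗ₜ[ℂ] Ω (Hdif.c k (n + 1)) := by
  rw [Finset.sum_range_succ', Hdif.c_zero, if_neg (Nat.succ_ne_zero n), map_zero,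
    TensorProduct.tmul_zero, add_zero]
  simp only [t_succ, TensorProduct.sum_tmul]
  rw [← Finset.sum_product', Finset.sum_sigma']
  symm
  refine Finset.sum_of_injOn (fun x => x.2) ?_ ?_ ?_ ?_
  · rintro ⟨i, p⟩ hx ⟨j, q⟩ hy h
    simp at hx hy h
    subst h
    obtain rfl : i = j := by omega
    rfl
  · rintro ⟨i, p⟩ hx
    simp at hx ⊢
    omega
  · rintro ⟨k, l⟩ hx h
    have : n + 1 < k + 1 + l := by
      by_contra hlt
      refine h ⟨⟨k + l, (k, l)⟩, ?_, rfl⟩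
      simp
      omega
    simp only [Hdif.c_lt this, map_zero, TensorProduct.tmul_zero]
  · rintro ⟨i, p⟩ hx
    simp only [Finset.mem_sigma, Finset.HasAntidiagonal.mem_antidiagonal] at hx
    rw [← hx.2, add_right_comm]

theorem Δ_δ_t (n : ℕ) : ∀ N, n < N →
    Htree.Δ (t n) = ∑ k ∈ Finset.range N, t k ⊗ₜ[ℂ] Ω (Hdif.c (k + 1) (n + 1)) ∧
      δ (t n) = ∑ k ∈ Finset.range N, t k ⊗ₜ[ℂ] Ω (Hdif.c k n) := by
  induction n using Nat.strong_induction_on with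
  | _ n ih =>
  intro N hN
  cases n with
  | zero =>
    rw [t_zero, map_one, δ_one]
    constructor
    all_goals
      rw [Finset.sum_eq_single 0]
      · simp [Hdif.c_self, t_zero, Algebra.TensorProduct.one_def]
      · intro k _ hk
        rw [Hdif.c_lt (by omega), map_zero, TensorProduct.tmul_zero]
      · intro h; simp at h; omega
  | succ n =>
    obtain ⟨N, rfl⟩ : ∃ M, N = M + 1 := ⟨N - 1, by omega⟩
    have hn : n < N := by omega
    have hδ : ∑ p ∈ Finset.HasAntidiagonal.antidiagonal n, Htree.Δ (t p.1) * δ (V (t p.2)) =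
        ∑ k ∈ Finset.range (N + 1), t k ⊗ₜ[ℂ] Ω (Hdif.c k (n + 1)) := by
      rw [← sum_t_mul_V_tmul n N hn]
      have e : ∀ p ∈ Finset.HasAntidiagonal.antidiagonal n,
          Htree.Δ (t p.1) * δ (V (t p.2)) = ∑ k ∈ Finset.range N, ∑ l ∈ Finset.range N,
            (t k * V (t l)) ⊗ₜ[ℂ] (Ω (Hdif.c (k + 1) (p.1 + 1)) * Ω (Hdif.c l p.2)) := by
        intro p hp
        rw [Finset.HasAntidiagonal.mem_antidiagonal] at hp
        rw [(ih p.1 (by omega) N (by omega)).1, δ_V_apply, (ih p.2 (by omega) N (by omega)).2,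
          map_sum, Finset.sum_mul_sum]
        simp only [LinearMap.rTensor_tmul, Algebra.TensorProduct.tmul_mul_tmul]
      rw [Finset.sum_congr rfl e, Finset.sum_comm]
      refine Finset.sum_congr rfl fun k _ => ?_
      rw [Finset.sum_comm]
      refine Finset.sum_congr rfl fun l _ => ?_
      rw [← TensorProduct.tmul_sum, Hdif.c_add, map_sum, Finset.Nat.sum_antidiagonal_succ]
      simp only [map_mul, Ω_c_zero_right, zero_mul, zero_add]
    constructor
    · have e : ∀ p ∈ Finset.HasAntidiagonal.antidiagonal n,
          Htree.Δ (t p.1) * (1 ⊗ₜ V (t p.2)) = ∑ k ∈ Finset.range (N + 1),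
            t k ⊗ₜ[ℂ] (Ω (Hdif.c (k + 1) (p.1 + 1)) * V (t p.2)) := by
        intro p hp
        rw [Finset.HasAntidiagonal.mem_antidiagonal] at hp
        rw [(ih p.1 (by omega) (N + 1) (by omega)).1, Finset.sum_mul]
        simp only [Algebra.TensorProduct.tmul_mul_tmul, mul_one]
      rw [t_succ, map_sum]
      simp only [map_mul, Δ_V_apply, mul_add, Finset.sum_add_distrib]
      rw [hδ, Finset.sum_congr rfl e, Finset.sum_comm, ← Finset.sum_add_distrib]
      refine Finset.sum_congr rfl fun k _ => ?_
      rw [Ω_c_succ, ← TensorProduct.tmul_sum, ← TensorProduct.tmul_add, add_comm]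
    · rw [← hδ, t_succ, map_sum]
      simp only [δ_mul_V]

/-! ### `Ω` as a homomorphism of bialgebras -/

theorem counit_comp_Ω : (Bialgebra.counitAlgHom ℂ Htree).comp Ω = Bialgebra.counitAlgHom ℂ Hdif := by
  refine Hdif.hom_ext fun n => ?_
  have h : Hdif.ε (Hdif.a (n + 1)) = 0 := Hdif.lift_a _ _
  refine Eq.trans ?_ h.symm
  show ε (Ω (Hdif.a (n + 1))) = 0
  rw [Ω_a, t_succ, map_sum]
  exact Finset.sum_eq_zero fun p _ => by rw [map_mul, ε_V, mul_zero]

theorem map_comp_comul_Ω : (Algebra.TensorProduct.map Ω Ω).comp (Bialgebra.comulAlgHom ℂ Hdif) =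
    (Bialgebra.comulAlgHom ℂ Htree).comp Ω := by
  refine Hdif.hom_ext fun n => ?_
  show Algebra.TensorProduct.map Ω Ω (Hdif.Δ (Hdif.a (n + 1))) = Htree.Δ (Ω (Hdif.a (n + 1)))
  rw [Ω_a, (Δ_δ_t (n + 1) (n + 2) (by omega)).1, ← Hdif.c_one_succ,
    Hdif.Δ_c_one (n + 2) (n + 3) (by omega), Finset.sum_range_succ', Hdif.c_one_zero]
  simp only [map_sum, Algebra.TensorProduct.map_tmul, Ω_c_one_succ,
    TensorProduct.zero_tmul, add_zero]

/-- `Ω` as a homomorphism of bialgebras. -/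
def ΩBialgHom : Hdif →ₐc[ℂ] Htree := BialgHom.ofAlgHom Ω counit_comp_Ω map_comp_comul_Ω

/-! ### A left inverse of `Ω` -/

/-- The right comb with `n` internal vertices. -/
def PBT.rightComb : ℕ → PBT
  | 0 => .nil
  | n + 1 => .node () .nil (rightComb n)

theorem PBT.numNodes_rightComb (n : ℕ) : (rightComb n).numNodes = n := by
  induction n with
  | zero => rfl
  | succ n ih => simp [rightComb, BinaryTree.numNodes, ih]

/-- The elements `b_n` with `a_{n+1} = ∑_{i+j=n} a_i b_j`. -/
def Hdif.b (n : ℕ) : Hdif := Hdif.a (n + 1) - ∑ j : Fin n, Hdif.a (n - j) * Hdif.b j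

theorem Hdif.a_succ (n : ℕ) : Hdif.a (n + 1) =
    ∑ p ∈ Finset.HasAntidiagonal.antidiagonal n, Hdif.a p.1 * Hdif.b p.2 := by
  rw [← Finset.Nat.sum_antidiagonal_swap, Finset.Nat.sum_antidiagonal_eq_sum_range_succ_mk,
    Finset.sum_range_succ]
  simp only [Prod.swap, Nat.sub_self]
  rw [Hdif.b, ← Fin.sum_univ_eq_sum_range (fun j => Hdif.a (n - j) * Hdif.b j)]
  rw [show Hdif.a 0 = 1 from rfl, one_mul, add_sub_cancel]

/-- The value on `V(s)` of the left inverse of `Ω`: `b_n` if `s` is the right comb with `n`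
internal vertices and `0` for all other trees. -/
def bComb (s : PBT) : Hdif := open Classical in
  if s = PBT.rightComb s.numNodes then Hdif.b s.numNodes else 0

theorem sum_bComb (n : ℕ) : ∑ s ∈ BinaryTree.treesOfNumNodesEq n, bComb s = Hdif.b n := by
  rw [Finset.sum_eq_single (PBT.rightComb n)]
  · rw [bComb, PBT.numNodes_rightComb, if_pos rfl]
  · intro s hs hne
    rw [BinaryTree.mem_treesOfNumNodesEq] at hs
    rw [bComb, hs, if_neg hne]
  · intro h
    exact absurd (BinaryTree.mem_treesOfNumNodesEq.2 (PBT.numNodes_rightComb n)) h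

/-- The left inverse of `Ω` on trees. -/
def leftInvTree : PBT → Hdif
  | .nil => 1
  | .node _ r s => leftInvTree r * bComb s

theorem leftInvTree_mul (r s : PBT) : leftInvTree (r * s) = leftInvTree r * leftInvTree s := by
  induction s with
  | nil => rw [← PBT.one_def, mul_one, PBT.one_def, leftInvTree, mul_one]
  | node _ u v hu _ => rw [PBT.mul_node, leftInvTree, leftInvTree, hu, mul_assoc]

/-- A left inverse of `Ω`. -/
def ΩLeftInv : Htree →ₐ[ℂ] Hdif := Htree.lift
  { toFun := leftInvTree
    map_one' := rfl
    map_mul' := leftInvTree_mul }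

theorem ΩLeftInv_tree (s : PBT) : ΩLeftInv (tree s) = leftInvTree s := Htree.lift_tree _ s

theorem ΩLeftInv_t (n : ℕ) : ΩLeftInv (t n) = Hdif.a n := by
  induction n using Nat.strong_induction_on with
  | _ n ih =>
  cases n with
  | zero => rw [t_zero, map_one]; rfl
  | succ n =>
    rw [Hdif.a_succ, t, map_sum, sum_treesOfNumNodesEq_succ]
    refine Finset.sum_congr rfl fun p hp => ?_
    rw [Finset.HasAntidiagonal.mem_antidiagonal] at hp
    simp only [ΩLeftInv_tree, leftInvTree]
    rw [← Finset.sum_mul_sum, sum_bComb, ← ih p.1 (by omega), t, map_sum]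
    simp only [ΩLeftInv_tree]

theorem ΩLeftInv_comp_Ω : ΩLeftInv.comp Ω = .id ℂ Hdif :=
  Hdif.hom_ext fun n => by simp [Ω_a, ΩLeftInv_t]

theorem Ω_injective : Function.Injective Ω :=
  Function.LeftInverse.injective (g := ΩLeftInv) fun x =>
    congrArg (fun f : Hdif →ₐ[ℂ] Hdif => f x) ΩLeftInv_comp_Ω

end NCDiff

end

theorem theorem4p1 :
    -- `Ω` is the homomorphism of unital algebras with `a_n ↦ t_n`
    (∀ n : ℕ, Ω (Hdif.a n) = Htree.t n) ∧
    -- `Ω` is injective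
    Function.Injective Ω ∧
    -- `Ω` is a homomorphism of co-algebras
    (∀ x : Hdif, Coalgebra.counit (R := ℂ) (Ω x) = Coalgebra.counit (R := ℂ) x) ∧
    (∀ x : Hdif, Coalgebra.comul (R := ℂ) (Ω x) =
      TensorProduct.map Ω.toLinearMap Ω.toLinearMap (Coalgebra.comul (R := ℂ) x)) ∧
    -- `Ω` identifies the Hopf algebra `Hdif` with a Hopf subalgebra of the tree Hopf algebra
    (∀ x : Hdif, HopfAlgebra.antipode ℂ (Ω x) = Ω (HopfAlgebra.antipode ℂ x)) ∧
    IsHopfSubalgebra Ω.range ∧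
    -- the right co-action on `t_n`: `δ t_n = ∑_{k=0}^n t_k ⊗ Q^{(k-1)}_{n-k}(t)`
    (∀ n : ℕ, Htree.δ (Htree.t n) =
      ∑ k ∈ Finset.range (n + 1), Htree.t k ⊗ₜ[ℂ] Qpoly Htree.t k (n - k)) := by
  refine ⟨Ω_a, Ω_injective, fun x => CoalgHomClass.counit_comp_apply ΩBialgHom x,
    fun x => (CoalgHomClass.map_comp_comul_apply ΩBialgHom x).symm,
    antipode_bialgHom_apply ΩBialgHom, isHopfSubalgebra_range ΩBialgHom, fun n => ?_⟩
  rw [(Δ_δ_t n (n + 1) n.lt_succ_self).2]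
  refine Finset.sum_congr rfl fun k hk => ?_
  rw [Ω_c k n (Finset.mem_range_succ_iff.1 hk)]
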